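/- Let $V\subset\mathbb{R}^3$ be a bounded, open, convex set, and let $\sigma_S,\sigma_F,\sigma_A:V\to\mathbb{R}$ be measurable functions, each bounded above and below on $V$ by strictly positive constants. Put $\sigma=\sigma_S+\sigma_F+\sigma_A$. For $\psi\in L^2(V\times\mathbb{S}^2;\mathbb{C})$ write $\phi(\mathbf r)=\frac1{4\pi}\int_{\mathbb{S}^2}\psi(\mathbf r,\Omega)\,\mathrm d\Omega$. A number $\lambda\in\mathbb{C}$ is called an eigenvalue if there is a function $\psi\in L^2(V\times\mathbb{S}^2;\mathbb{C})$, not almost everywhere zero and locally absolutely continuous along almost every characteristic line $s\mapsto \mathbf r+s\Omega$ inside $V$, such that $$\Omega\cdot\nabla\psi(\mathbf r,\Omega)+\sigma(\mathbf r)\psi(\mathbf r,\Omega)=\sigma_S(\mathbf r)\phi(\mathbf r)+\lambda\,\sigma_F(\mathbf r)\phi(\mathbf r)\qquad\text{for almost every }(\mathbf r,\Omega)\in V\times\mathbb{S}^2,$$ where $\Omega\cdot\nabla\psi$ is the derivative of $\psi(\cdot,\Omega)$ in direction $\Omega$, subject to the vacuum boundary condition $\psi(\mathbf r,\Omega)=0$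 for $\mathbf r\in\partial V$, $\mathbf n(\mathbf r)\cdot\Omega<0$, where $\mathbf n$ is the unit outward normal of $V$ and the boundary value is the limit along the characteristic entering $V$ at $\mathbf r$ (for almost every characteristic). Then every eigenvalue $\lambda$ is real and positive. -/

import Mathlib

open MeasureTheory Filter Topology

/-- Position space `ℝ³` with its Euclidean norm. -/
abbrev R3 : Type := EuclideanSpace ℝ (Fin 3)

/-- The unit sphere `𝕊²` of directions. -/
abbrev S2 : Type := Metric.sphere (0 : R3) 1

/-- The surface measure `dΩ` on `𝕊²` (of total mass `4π`). -/
noncomputable def surfaceMeasure : Measure S2 := (volume : Measure R3).toSphere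

/-- The measure `dr dΩ` on the phase space `V × 𝕊²`. -/
noncomputable def phaseMeasure (V : Set R3) : Measure (R3 × S2) :=
  (volume.restrict V).prod surfaceMeasure

/-- A cross-section on `V`: a (Lebesgue) measurable function that is pointwise bounded above and
below on `V` by strictly positive constants. Its values outside `V` play no role. -/
def IsCrossSection (V : Set R3) (σ : R3 → ℝ) : Prop :=
  AEMeasurable σ (volume.restrict V) ∧ ∃ c C : ℝ, 0 < c ∧ ∀ r ∈ V, c ≤ σ r ∧ σ r ≤ C

/-- The scalar flux `φ(r) = (1/4π) ∫_{𝕊²} ψ(r, Ω) dΩ` of the angular flux `ψ`. -/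
noncomputable def scalarFlux (ψ : R3 → S2 → ℂ) (r : R3) : ℂ :=
  (1 / (4 * (Real.pi : ℂ))) * ∫ Ω, ψ r Ω ∂surfaceMeasure

/-- `n` is a unit outward normal of the convex set `V` at the boundary point `p`. -/
def IsOutwardNormal (V : Set R3) (p n : R3) : Prop :=
  ‖n‖ = 1 ∧ ∀ x ∈ V, inner ℝ n (x - p) ≤ 0

/-- The inflow boundary: the pairs `(p, Ω)` with `p ∈ ∂V` and `n(p) · Ω < 0`. (At the exceptional
boundary points with several unit outward normals, all of them are meant. For an open convex `V`
these are exactly the pairs for which the ray from `p` in direction `Ω` enters `V` at `p`.) -/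
def inflowBoundary (V : Set R3) : Set (R3 × S2) :=
  {z | z.1 ∈ frontier V ∧ ∀ n, IsOutwardNormal V z.1 n → inner ℝ n (z.2 : R3) < 0}

/-- `ψ` is locally absolutely continuous along almost every characteristic
`s ↦ r + s Ω` inside `V`. -/
def IsACAlongCharacteristics (V : Set R3) (ψ : R3 → S2 → ℂ) : Prop :=
  ∀ᵐ z ∂(phaseMeasure V), ∀ a b : ℝ,
    (∀ s ∈ Set.uIcc a b, z.1 + s • (z.2 : R3) ∈ V) →
      AbsolutelyContinuousOnInterval (fun s : ℝ => ψ (z.1 + s • (z.2 : R3)) z.2) a b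

/-- The vacuum boundary condition: `ψ` vanishes on the inflow boundary, the boundary value being
the limit along the characteristic that enters `V` there (for almost every characteristic). -/
def VacuumBC (V : Set R3) (ψ : R3 → S2 → ℂ) : Prop :=
  ∀ᵐ z ∂(phaseMeasure V), ∀ s : ℝ, (z.1 + s • (z.2 : R3), z.2) ∈ inflowBoundary V →
    Tendsto (fun t : ℝ => ψ (z.1 + s • (z.2 : R3) + t • (z.2 : R3)) z.2) (𝓝[>] 0) (𝓝 0)

/-- The equation `Ω · ∇ψ + σ ψ = σ_S φ + lam σ_F φ`, almost everywhere in `V × 𝕊²`, where `φ` is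
the scalar flux of `ψ` and `Ω · ∇ψ` is the derivative of `ψ(·, Ω)` in the direction `Ω`. -/
def SatisfiesEigenEquation (V : Set R3) (σ σS σF : R3 → ℝ) (lam : ℂ) (ψ : R3 → S2 → ℂ) : Prop :=
  ∀ᵐ z ∂(phaseMeasure V),
    LineDifferentiableAt ℝ (fun x => ψ x z.2) z.1 (z.2 : R3) ∧
    lineDeriv ℝ (fun x => ψ x z.2) z.1 (z.2 : R3) + (σ z.1 : ℂ) * ψ z.1 z.2 =
      (σS z.1 : ℂ) * scalarFlux ψ z.1 + lam * (σF z.1 : ℂ) * scalarFlux ψ z.1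

/-- `(lam, ψ)` is an eigenpair of the criticality problem with vacuum boundary condition: `ψ` is a
complex-valued element of `L²(V × 𝕊²)`, not almost everywhere zero, that is locally absolutely
continuous along characteristics, solves the equation and satisfies the boundary condition. -/
structure IsEigenpair (V : Set R3) (σ σS σF : R3 → ℝ) (lam : ℂ) (ψ : R3 → S2 → ℂ) : Prop where
  memLp : MemLp (Function.uncurry ψ) 2 (phaseMeasure V)
  nonzero : ¬ (Function.uncurry ψ =ᵐ[phaseMeasure V] 0)
  absolutelyContinuous : IsACAlongCharacteristics V ψ
  equation : SatisfiesEigenEquation V σ σS σF lam ψ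
  vacuum : VacuumBC V ψ

/-- `lam ∈ ℂ` is an eigenvalue of the criticality problem. -/
def IsCriticalityEigenvalue (V : Set R3) (σ σS σF : R3 → ℝ) (lam : ℂ) : Prop :=
  ∃ ψ : R3 → S2 → ℂ, IsEigenpair V σ σS σF lam ψ

/-! Write q = σ_S φ + λ σ_F φ for the source and test the equation with ψ in two ways. Since q does
not depend on Ω, ∫∫ q ψ̄ = 4π (∫ σ_S |φ|² + λ ∫ σ_F |φ|²), so λ can be read off once this number is
controlled.

Energy: along a characteristic, 2 Re(ψ' ψ̄) is the derivative of |ψ|², which vanishes at the entry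
point and is nonnegative at the exit. Hence ∫∫ σ|ψ|² ≤ Re ∫∫ q ψ̄
(`IsEigenpair.integral_mul_sq_norm_le`). If φ = 0 then q = 0 and this forces ψ = 0, so ∫ σ_F |φ|² >
0.

Reality: test instead with ψ(·, -Ω). It vanishes where the characteristic leaves V, so integration
by parts has no boundary terms. The σ terms cancel, and I(Ω) = ∫ q ψ̄(·, Ω) satisfies I(-Ω) = conj
I(Ω). Integration over the sphere makes ∫∫ q ψ̄ real (`IsEigenpair.integral_source_mul_star_im`),
hence λ is real.

Positivity: Cauchy-Schwarz in Ω gives 4π ∫ σ|φ|² ≤ ∫∫ σ|ψ|². With the energy bound and σ ≥ σ_S +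
σ_F, ∫ σ_F |φ|² ≤ Re λ ∫ σ_F |φ|². -/

/-! ### Calculus of absolutely continuous functions of one variable -/

namespace AbsolutelyContinuousOnInterval

/-- Serves to pass absolute continuity to conjugates, to real and imaginary parts, and to pointwise
rewritings of the same function. -/
theorem of_dist_le {X Y : Type*} [PseudoMetricSpace X] [PseudoMetricSpace Y] {f : ℝ → X}
    {g : ℝ → Y} {a b : ℝ} (hf : AbsolutelyContinuousOnInterval f a b)
    (h : ∀ x y, dist (g x) (g y) ≤ dist (f x) (f y)) :
    AbsolutelyContinuousOnInterval g a b := by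
  rw [absolutelyContinuousOnInterval_iff] at hf ⊢
  intro ε hε
  obtain ⟨δ, hδ, H⟩ := hf ε hε
  exact ⟨δ, hδ, fun E hE hs => (Finset.sum_le_sum fun i _ => h _ _).trans_lt (H E hE hs)⟩

theorem comp_neg {X : Type*} [PseudoMetricSpace X] {f : ℝ → X} {a b : ℝ}
    (hf : AbsolutelyContinuousOnInterval f (-a) (-b)) :
    AbsolutelyContinuousOnInterval (fun x => f (-x)) a b := by
  rw [absolutelyContinuousOnInterval_iff] at hf ⊢
  intro ε hε
  obtain ⟨δ, hδ, H⟩ := hf ε hε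
  refine ⟨δ, hδ, fun E hE hs => H (E.1, fun i => (-(E.2 i).1, -(E.2 i).2)) ⟨?_, ?_⟩ ?_⟩
  · intro i hi
    have := hE.1 i hi
    simp only [Set.mem_uIcc] at this ⊢
    grind
  · intro i hi j hj hij
    have := hE.2 hi hj hij
    simp only [Function.onFun, Set.uIoc, Set.Ioc_disjoint_Ioc] at this ⊢
    grind
  · simpa using hs

theorem comp_add_const {X : Type*} [PseudoMetricSpace X] {f : ℝ → X} {a b : ℝ} (t : ℝ)
    (hf : AbsolutelyContinuousOnInterval f (a + t) (b + t)) :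
    AbsolutelyContinuousOnInterval (fun x => f (x + t)) a b := by
  rw [absolutelyContinuousOnInterval_iff] at hf ⊢
  intro ε hε
  obtain ⟨δ, hδ, H⟩ := hf ε hε
  refine ⟨δ, hδ, fun E hE hs => H (E.1, fun i => ((E.2 i).1 + t, (E.2 i).2 + t)) ⟨?_, ?_⟩ ?_⟩
  · intro i hi
    have := hE.1 i hi
    simp only [Set.mem_uIcc] at this ⊢
    grind
  · intro i hi j hj hij
    have := hE.2 hi hj hij
    simp only [Function.onFun, Set.uIoc, Set.Ioc_disjoint_Ioc] at this ⊢
    grind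
  · simpa using hs

/-- The fundamental theorem for real functions, applied to the real and imaginary parts. -/
theorem integral_eq_sub_of_ae_hasDerivAt {f f' : ℝ → ℂ} {a b : ℝ} (hab : a ≤ b)
    (hf : AbsolutelyContinuousOnInterval f a b)
    (hd : ∀ᵐ s ∂volume.restrict (Set.Ioo a b), HasDerivAt f (f' s) s)
    (hi : IntervalIntegrable f' volume a b) :
    ∫ s in a..b, f' s = f b - f a := by
  have key (L : ℂ →L[ℝ] ℝ) (hL : ∀ z, |L z| ≤ ‖z‖) : L (∫ s in a..b, f' s) = L (f b - f a) := by
    have h1 : AbsolutelyContinuousOnInterval (fun s => L (f s)) a b :=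
      hf.of_dist_le fun x y => by
        rw [Real.dist_eq, dist_eq_norm, ← map_sub]; exact hL _
    rw [← L.intervalIntegral_comp_comm hi, map_sub, ← h1.integral_deriv_eq_sub,
      intervalIntegral.integral_of_le hab, intervalIntegral.integral_of_le hab,
      integral_Ioc_eq_integral_Ioo, integral_Ioc_eq_integral_Ioo]
    refine integral_congr_ae ?_
    filter_upwards [hd] with s hs
    exact (L.hasFDerivAt.comp_hasDerivAt s hs).deriv.symm
  exact Complex.ext (key Complex.reCLM Complex.abs_re_le_norm)
    (key Complex.imCLM Complex.abs_im_le_norm)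

end AbsolutelyContinuousOnInterval

/-- `f` is locally absolutely continuous on `(a, b)`, with almost everywhere derivative `f'`. -/
structure HasLocalACDeriv (f f' : ℝ → ℂ) (a b : ℝ) : Prop where
  ac : ∀ c d, c ∈ Set.Ioo a b → d ∈ Set.Ioo a b → AbsolutelyContinuousOnInterval f c d
  deriv : ∀ᵐ s ∂volume.restrict (Set.Ioo a b), HasDerivAt f (f' s) s

namespace HasLocalACDeriv

variable {f f' g g' : ℝ → ℂ} {a b : ℝ}

theorem mul (hf : HasLocalACDeriv f f' a b) (hg : HasLocalACDeriv g g' a b) :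
    HasLocalACDeriv (fun s => f s * g s) (fun s => f' s * g s + f s * g' s) a b where
  ac c d hc hd := (hf.ac c d hc hd).smul (hg.ac c d hc hd)
  deriv := by
    filter_upwards [hf.deriv, hg.deriv] with s h1 h2 using h1.mul h2

theorem conj (hf : HasLocalACDeriv f f' a b) :
    HasLocalACDeriv (fun s => star (f s)) (fun s => star (f' s)) a b where
  ac c d hc hd := (hf.ac c d hc hd).of_dist_le fun x y => (dist_star_star _ _).le
  deriv := by
    filter_upwards [hf.deriv] with s h1 using h1.star

theorem comp_neg (hf : HasLocalACDeriv f f' a b) :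
    HasLocalACDeriv (fun s => f (-s)) (fun s => -f' (-s)) (-b) (-a) where
  ac c d hc hd := (hf.ac (-c) (-d) ⟨by linarith [hc.2], by linarith [hc.1]⟩
    ⟨by linarith [hd.2], by linarith [hd.1]⟩).comp_neg
  deriv := by
    have h := (Measure.measurePreserving_neg (volume : Measure ℝ)).quasiMeasurePreserving.ae
      ((ae_restrict_iff' measurableSet_Ioo).1 hf.deriv)
    rw [ae_restrict_iff' measurableSet_Ioo]
    filter_upwards [h] with s hs hm
    have := (hs ⟨by linarith [hm.2], by linarith [hm.1]⟩).scomp s (hasDerivAt_neg s)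
    simpa [Function.comp_def] using this

/-- Integrability of f' up to the ends makes its primitive continuous on the closed interval, and
the primitive agrees with f inside. The values of f at a and b play no role. -/
theorem exists_tendsto (hab : a < b) (hf : HasLocalACDeriv f f' a b)
    (hi : IntegrableOn f' (Set.Ioo a b)) :
    ∃ A B, Tendsto f (𝓝[>] a) (𝓝 A) ∧ Tendsto f (𝓝[<] b) (𝓝 B) ∧
      ∫ s in Set.Ioo a b, f' s = B - A := by
  obtain ⟨m, hm⟩ := exists_between hab
  have hi' : IntervalIntegrable f' volume a b := by
    rw [intervalIntegrable_iff_integrableOn_Ioo_of_le hab.le]; exact hi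
  have hsub {c d : ℝ} (hc : c ∈ Set.Icc a b) (hd : d ∈ Set.Icc a b) :
      IntervalIntegrable f' volume c d := by
    refine hi'.mono_set ?_
    rw [Set.uIcc_of_le hab.le]
    exact Set.ordConnected_Icc.uIcc_subset hc hd
  have hcont : ContinuousOn (fun s => f m + ∫ x in m..s, f' x) (Set.Icc a b) := by
    have := intervalIntegral.continuousOn_primitive_interval' hi' (a := m)
      (by rw [Set.uIcc_of_le hab.le]; exact ⟨hm.1.le, hm.2.le⟩)
    rw [Set.uIcc_of_le hab.le] at this
    exact continuousOn_const.add this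
  have hmI : m ∈ Set.Icc a b := ⟨hm.1.le, hm.2.le⟩
  have heq : ∀ s ∈ Set.Ioo a b, f m + ∫ x in m..s, f' x = f s := by
    intro s hs
    rcases le_total m s with h | h
    · rw [(hf.ac m s hm hs).integral_eq_sub_of_ae_hasDerivAt h
        (ae_restrict_of_ae_restrict_of_subset (Set.Ioo_subset_Ioo hm.1.le hs.2.le) hf.deriv)
        (hsub hmI ⟨hs.1.le, hs.2.le⟩)]
      ring
    · rw [intervalIntegral.integral_symm,
        (hf.ac s m hs hm).integral_eq_sub_of_ae_hasDerivAt h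
        (ae_restrict_of_ae_restrict_of_subset (Set.Ioo_subset_Ioo hs.1.le hm.2.le) hf.deriv)
        (hsub ⟨hs.1.le, hs.2.le⟩ hmI)]
      ring
  refine ⟨f m + ∫ x in m..a, f' x, f m + ∫ x in m..b, f' x, ?_, ?_, ?_⟩
  · have h := (hcont a ⟨le_rfl, hab.le⟩).mono Set.Ioo_subset_Icc_self
    rw [ContinuousWithinAt, nhdsWithin_Ioo_eq_nhdsGT hab] at h
    exact h.congr' (by filter_upwards [Ioo_mem_nhdsGT hab] with s hs using heq s hs)
  · have h := (hcont b ⟨hab.le, le_rfl⟩).mono Set.Ioo_subset_Icc_self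
    rw [ContinuousWithinAt, nhdsWithin_Ioo_eq_nhdsLT hab] at h
    exact h.congr' (by filter_upwards [Ioo_mem_nhdsLT hab] with s hs using heq s hs)
  · rw [← integral_Ioc_eq_integral_Ioo, ← intervalIntegral.integral_of_le hab.le,
      ← intervalIntegral.integral_add_adjacent_intervals (hsub ⟨le_rfl, hab.le⟩ hmI)
        (hsub hmI ⟨hab.le, le_rfl⟩), intervalIntegral.integral_symm m a]
    ring

/-- One-dimensional energy estimate for `f` with vanishing limit at the left end point. -/
theorem integral_re_mul_star_nonneg (hab : a < b) (hf : HasLocalACDeriv f f' a b)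
    (hi : IntegrableOn f' (Set.Ioo a b)) (h0 : Tendsto f (𝓝[>] a) (𝓝 0))
    (hp : IntegrableOn (fun s => f' s * star (f s)) (Set.Ioo a b)) :
    0 ≤ ∫ s in Set.Ioo a b, (f' s * star (f s)).re := by
  obtain ⟨-, B, -, hB, -⟩ := hf.exists_tendsto hab hi
  have hp' : IntegrableOn (fun s => f' s * star (f s) + f s * star (f' s)) (Set.Ioo a b) := by
    refine hp.add ?_
    have : Integrable (fun s => Complex.conjCLE (f' s * star (f s)))
      (volume.restrict (Set.Ioo a b)) := Complex.conjCLE.toContinuousLinearMap.integrable_comp hp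
    refine this.congr (ae_of_all _ fun s => ?_)
    simp [mul_comm]
  obtain ⟨A', B', hA', hB', hint⟩ := (hf.mul hf.conj).exists_tendsto hab hp'
  have hA0 : A' = 0 := tendsto_nhds_unique hA' (by simpa using h0.mul h0.star)
  have hB0 : B' = B * star B := tendsto_nhds_unique hB' (hB.mul hB.star)
  -- The derivative of f f̄ has real part 2 Re(f' f̄), so the integral is half the boundary
  -- difference, namely |B|² / 2.
  have hre : ∫ s in Set.Ioo a b, (f' s * star (f s)).re = (B' - A').re / 2 := by
    rw [← hint]
    have := Complex.reCLM.integral_comp_comm hp'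
    simp only [Complex.reCLM_apply] at this
    rw [← this, ← integral_div]
    refine integral_congr_ae (ae_of_all _ fun s => ?_)
    simp
    ring
  rw [hre, hA0, hB0, sub_zero]
  have : (B * star B).re = ‖B‖ ^ 2 := by
    rw [← Complex.normSq_eq_norm_sq, Complex.normSq_apply]; simp
  rw [this]
  positivity

/-- Integration by parts without boundary terms: `f` vanishes at the left end point, `g` at the
right one. -/
theorem integral_mul_eq_zero (hab : a < b) (hf : HasLocalACDeriv f f' a b)
    (hg : HasLocalACDeriv g g' a b)
    (hfi : IntegrableOn f' (Set.Ioo a b)) (hgi : IntegrableOn g' (Set.Ioo a b))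
    (hf0 : Tendsto f (𝓝[>] a) (𝓝 0)) (hg0 : Tendsto g (𝓝[<] b) (𝓝 0))
    (hp : IntegrableOn (fun s => f' s * g s + f s * g' s) (Set.Ioo a b)) :
    ∫ s in Set.Ioo a b, f' s * g s + f s * g' s = 0 := by
  obtain ⟨-, B, -, hB, -⟩ := hf.exists_tendsto hab hfi
  obtain ⟨A, -, hA, -, -⟩ := hg.exists_tendsto hab hgi
  obtain ⟨A', B', hA', hB', hint⟩ := (hf.mul hg).exists_tendsto hab hp
  have hA0 : A' = 0 := tendsto_nhds_unique hA' (by simpa using hf0.mul hA)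
  have hB0 : B' = 0 := tendsto_nhds_unique hB' (by simpa using hB.mul hg0)
  rw [hint, hA0, hB0, sub_zero]

end HasLocalACDeriv

/-! ### Lines in a fixed direction and their intersections with V -/

/-- Every direction `Ω` admits measure preserving coordinates `(y, s) ↦ p y + s Ω` on `ℝ³`. -/
theorem exists_line_coordinates (Ω : S2) :
    ∃ p : (Fin 2 → ℝ) → R3,
      MeasurePreserving (fun z : (Fin 2 → ℝ) × ℝ => p z.1 + z.2 • (Ω : R3))
        (volume.prod volume) volume ∧
      MeasurableEmbedding (fun z : (Fin 2 → ℝ) × ℝ => p z.1 + z.2 • (Ω : R3)) := by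
  have horth : Orthonormal ℝ (({0} : Set (Fin 3)).domRestrict fun _ => (Ω : R3)) := by
    refine ⟨fun i => by simp, fun i j hij => (hij (Subsingleton.elim i j)).elim⟩
  -- Ω becomes the basis vector of index 0, so the coordinate split off by `piFinSuccAbove` is arc
  -- length along Ω.
  obtain ⟨b, hb⟩ := horth.exists_orthonormalBasis_extension_of_card_eq (by simp)
  have hb0 : b 0 = Ω := hb 0 rfl
  let e₁ : (Fin 2 → ℝ) × ℝ ≃ᵐ (Fin 3 → ℝ) :=
    MeasurableEquiv.prodComm.trans (MeasurableEquiv.piFinSuccAbove (fun _ => ℝ) 0).symm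
  have h₁ : MeasurePreserving e₁ (volume.prod volume) volume :=
    (volume_preserving_piFinSuccAbove (fun _ : Fin 3 => ℝ) 0).symm.comp Measure.measurePreserving_swap
  let e : (Fin 2 → ℝ) × ℝ ≃ᵐ R3 :=
    (e₁.trans (MeasurableEquiv.toLp 2 (Fin 3 → ℝ))).trans b.repr.symm.toMeasurableEquiv
  have he : MeasurePreserving e (volume.prod volume) volume :=
    b.measurePreserving_repr_symm.comp ((PiLp.volume_preserving_toLp (Fin 3)).comp h₁)
  have hfun : (fun z : (Fin 2 → ℝ) × ℝ => e (z.1, 0) + z.2 • (Ω : R3)) = e := by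
    have happ : ∀ z : (Fin 2 → ℝ) × ℝ, e z = z.2 • b 0 + (z.1 0 • b 1 + z.1 1 • b 2) := by
      intro z
      change b.repr.symm (WithLp.toLp 2 (Fin.insertNth 0 z.2 z.1 : Fin 3 → ℝ)) = _
      rw [← b.sum_repr_symm, Fin.sum_univ_three, add_assoc]
      rfl
    funext z
    rw [happ, happ, hb0]
    simp [add_comm]
  exact ⟨fun y => e (y, 0), by rw [hfun]; exact he, by rw [hfun]; exact e.measurableEmbedding⟩

section Slices

variable {Ω : S2} {p : (Fin 2 → ℝ) → R3} {V : Set R3}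

theorem ae_ae_line (hp : MeasurePreserving (fun z : (Fin 2 → ℝ) × ℝ => p z.1 + z.2 • (Ω : R3))
      (volume.prod volume) volume) (hV : MeasurableSet V) {P : R3 → Prop}
    (h : ∀ᵐ r ∂volume.restrict V, P r) :
    ∀ᵐ y, ∀ᵐ s : ℝ, p y + s • (Ω : R3) ∈ V → P (p y + s • (Ω : R3)) :=
  Measure.ae_ae_of_ae_prod (hp.quasiMeasurePreserving.ae ((ae_restrict_iff' hV).1 h))

variable {E : Type*} [NormedAddCommGroup E]

theorem ae_integrableOn_line
    (hp : MeasurePreserving (fun z : (Fin 2 → ℝ) × ℝ => p z.1 + z.2 • (Ω : R3))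
      (volume.prod volume) volume)
    (hpe : MeasurableEmbedding (fun z : (Fin 2 → ℝ) × ℝ => p z.1 + z.2 • (Ω : R3)))
    (hV : MeasurableSet V) {f : R3 → E} (hf : IntegrableOn f V) :
    ∀ᵐ y, IntegrableOn (fun s : ℝ => f (p y + s • (Ω : R3))) {s | p y + s • (Ω : R3) ∈ V} := by
  have h := (hp.integrable_comp_emb hpe).2 ((integrable_indicator_iff hV).2 hf)
  filter_upwards [h.prod_right_ae] with y hy
  have hm : MeasurableSet {s : ℝ | p y + s • (Ω : R3) ∈ V} :=
    hV.preimage (by fun_prop)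
  rw [← integrable_indicator_iff hm]
  exact hy

theorem setIntegral_eq_integral_line [NormedSpace ℝ E]
    (hp : MeasurePreserving (fun z : (Fin 2 → ℝ) × ℝ => p z.1 + z.2 • (Ω : R3))
      (volume.prod volume) volume)
    (hpe : MeasurableEmbedding (fun z : (Fin 2 → ℝ) × ℝ => p z.1 + z.2 • (Ω : R3)))
    (hV : MeasurableSet V) {f : R3 → E} (hf : IntegrableOn f V) :
    ∫ r in V, f r = ∫ y, ∫ s in {s : ℝ | p y + s • (Ω : R3) ∈ V}, f (p y + s • (Ω : R3)) := by
  have h := (hp.integrable_comp_emb hpe).2 ((integrable_indicator_iff hV).2 hf)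
  rw [← integral_indicator hV, ← hp.integral_comp hpe]
  refine (integral_prod _ h).trans (integral_congr_ae (ae_of_all _ fun y => ?_))
  have hm : MeasurableSet {s : ℝ | p y + s • (Ω : R3) ∈ V} :=
    hV.preimage (by fun_prop)
  dsimp only
  rw [← integral_indicator hm]
  rfl

end Slices

/-- A nonempty intersection of a bounded open convex set with a line is an open interval. -/
theorem exists_slice_eq_Ioo {V : Set R3} (hVo : IsOpen V) (hVc : Convex ℝ V)
    (hVb : Bornology.IsBounded V) (Ω : S2) (p : R3)
    (hne : {s : ℝ | p + s • (Ω : R3) ∈ V}.Nonempty) :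
    ∃ a b, a < b ∧ {s : ℝ | p + s • (Ω : R3) ∈ V} = Set.Ioo a b := by
  set I := {s : ℝ | p + s • (Ω : R3) ∈ V} with hI
  have ho : IsOpen I := hVo.preimage (by fun_prop)
  have hc : Convex ℝ I := by
    intro x hx y hy α β hα hβ hαβ
    have := hVc hx hy hα hβ hαβ
    have h2 : α • (p + x • (Ω : R3)) + β • (p + y • (Ω : R3)) =
        (α + β) • p + (α • x + β • y) • (Ω : R3) := by
      simp only [smul_add, add_smul, smul_smul, smul_eq_mul]; abel
    rw [h2, hαβ, one_smul] at this
    exact this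
  obtain ⟨R, hR⟩ := hVb.subset_closedBall (p : R3)
  have hsub : I ⊆ Set.Icc (-R) R := by
    intro s hs
    have := hR hs
    simp only [Metric.mem_closedBall, dist_self_add_left, norm_smul, Real.norm_eq_abs] at this
    rw [norm_eq_of_mem_sphere, mul_one] at this
    exact abs_le.1 this
  have hbb : BddBelow I := ⟨-R, fun s hs => (hsub hs).1⟩
  have hba : BddAbove I := ⟨R, fun s hs => (hsub hs).2⟩
  have hconn : IsConnected I := ⟨hne, hc.isPreconnected⟩
  have heq : I = Set.Ioo (sInf I) (sSup I) := by
    refine Set.Subset.antisymm ?_ (hconn.Ioo_csInf_csSup_subset hbb hba)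
    have := interior_mono (subset_Icc_csInf_csSup hbb hba)
    rwa [ho.interior_eq, interior_Icc] at this
  refine ⟨sInf I, sSup I, ?_, heq⟩
  rw [heq] at hne
  exact Set.nonempty_Ioo.1 hne

/-- The entry point of a line into an open set lies on the inflow boundary. -/
theorem entry_mem_inflowBoundary {V : Set R3} (hVo : IsOpen V) {Ω : S2} {p : R3} {a b : ℝ}
    (hab : a < b) (hs : {s : ℝ | p + s • (Ω : R3) ∈ V} = Set.Ioo a b) :
    (p + a • (Ω : R3), Ω) ∈ inflowBoundary V := by
  have hmem : ∀ s, p + s • (Ω : R3) ∈ V ↔ s ∈ Set.Ioo a b := fun s => by rw [← hs]; rfl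
  refine ⟨?_, fun n hn => ?_⟩
  · rw [hVo.frontier_eq]
    refine ⟨?_, fun h => lt_irrefl a ((hmem a).1 h).1⟩
    have hcont : Tendsto (fun s : ℝ => p + s • (Ω : R3)) (𝓝[>] a) (𝓝 (p + a • (Ω : R3))) :=
      (Continuous.tendsto (by fun_prop) a).mono_left nhdsWithin_le_nhds
    refine mem_closure_of_tendsto hcont ?_
    filter_upwards [Ioo_mem_nhdsGT hab] with s hs' using (hmem s).2 hs'
  · obtain ⟨m, hm⟩ := exists_between hab
    have hmV := (hmem m).2 hm
    -- Pushing an interior point of the chord by ε/2 along n stays in V. The outward normal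
    -- inequality there reads (m - a) n·Ω + ε/2 ≤ 0, which makes n·Ω strictly negative.
    obtain ⟨ε, hε, hball⟩ := Metric.isOpen_iff.1 hVo _ hmV
    have hx : p + m • (Ω : R3) + (ε / 2) • n ∈ V := by
      apply hball
      simp only [Metric.mem_ball, dist_self_add_left, norm_smul, hn.1, mul_one, Real.norm_eq_abs]
      rw [abs_of_pos (by positivity)]
      linarith
    have h := hn.2 _ hx
    have h2 : p + m • (Ω : R3) + (ε / 2) • n - (p + a • (Ω : R3)) =
        (m - a) • (Ω : R3) + (ε / 2) • n := by
      rw [sub_smul]; abel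
    dsimp only at h
    rw [h2, inner_add_right, inner_smul_right, inner_smul_right, real_inner_self_eq_norm_sq,
      hn.1] at h
    have hma : 0 < m - a := sub_pos.2 hm.1
    dsimp only
    by_contra hcon
    push Not at hcon
    have := mul_nonneg hma.le hcon
    linarith

/-! ### Energy estimate and antipodal identity in one direction -/

/-- `f` is the restriction to the direction `Ω` of a function that is locally absolutely continuous
along characteristics, vanishes on the inflow boundary, and has derivative `f'` in direction `Ω`. -/
structure IsTransportSolution (V : Set R3) (Ω : S2) (f f' : R3 → ℂ) : Prop where
  ac : ∀ᵐ r ∂volume.restrict V, ∀ a b : ℝ, (∀ s ∈ Set.uIcc a b, r + s • (Ω : R3) ∈ V) →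
    AbsolutelyContinuousOnInterval (fun s : ℝ => f (r + s • (Ω : R3))) a b
  vacuum : ∀ᵐ r ∂volume.restrict V, ∀ s : ℝ, (r + s • (Ω : R3), Ω) ∈ inflowBoundary V →
    Tendsto (fun t : ℝ => f (r + s • (Ω : R3) + t • (Ω : R3))) (𝓝[>] 0) (𝓝 0)
  deriv : ∀ᵐ r ∂volume.restrict V, HasLineDerivAt ℝ f (f' r) r (Ω : R3)
  integrable : IntegrableOn f' V

/-- Absolute continuity and the boundary limit concern the whole chord, so one good base point s₀ on
it yields both by translation. Only the derivative is needed at almost every point. -/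
theorem hasLocalACDeriv_line {V : Set R3} (hVo : IsOpen V) {Ω : S2} {f f' : R3 → ℂ} {p : R3}
    {a b : ℝ} (hab : a < b) (hI : {s : ℝ | p + s • (Ω : R3) ∈ V} = Set.Ioo a b)
    (hac : ∀ᵐ s₀ : ℝ, p + s₀ • (Ω : R3) ∈ V → ∀ a b : ℝ,
      (∀ s ∈ Set.uIcc a b, p + s₀ • (Ω : R3) + s • (Ω : R3) ∈ V) →
      AbsolutelyContinuousOnInterval (fun s : ℝ => f (p + s₀ • (Ω : R3) + s • (Ω : R3))) a b)
    (hvac : ∀ᵐ s₀ : ℝ, p + s₀ • (Ω : R3) ∈ V → ∀ s : ℝ,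
      (p + s₀ • (Ω : R3) + s • (Ω : R3), Ω) ∈ inflowBoundary V →
      Tendsto (fun t : ℝ => f (p + s₀ • (Ω : R3) + s • (Ω : R3) + t • (Ω : R3))) (𝓝[>] 0) (𝓝 0))
    (hder : ∀ᵐ s : ℝ, p + s • (Ω : R3) ∈ V →
      HasLineDerivAt ℝ f (f' (p + s • (Ω : R3))) (p + s • (Ω : R3)) (Ω : R3)) :
    HasLocalACDeriv (fun s => f (p + s • (Ω : R3))) (fun s => f' (p + s • (Ω : R3))) a b ∧
      Tendsto (fun s => f (p + s • (Ω : R3))) (𝓝[>] a) (𝓝 0) := by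
  have hmem : ∀ s, p + s • (Ω : R3) ∈ V ↔ s ∈ Set.Ioo a b := fun s => by rw [← hI]; rfl
  have hadd : ∀ s t : ℝ, p + s • (Ω : R3) + t • (Ω : R3) = p + (t + s) • (Ω : R3) := fun s t => by
    rw [add_assoc, ← add_smul, add_comm s t]
  obtain ⟨s₀, hs₀, h₁, h₂⟩ : ∃ s₀ ∈ Set.Ioo a b,
      (∀ c d : ℝ, (∀ s ∈ Set.uIcc c d, p + s₀ • (Ω : R3) + s • (Ω : R3) ∈ V) →
        AbsolutelyContinuousOnInterval (fun s : ℝ => f (p + s₀ • (Ω : R3) + s • (Ω : R3))) c d) ∧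
      (∀ s : ℝ, (p + s₀ • (Ω : R3) + s • (Ω : R3), Ω) ∈ inflowBoundary V →
        Tendsto (fun t : ℝ => f (p + s₀ • (Ω : R3) + s • (Ω : R3) + t • (Ω : R3)))
          (𝓝[>] 0) (𝓝 0)) := by
    have hfreq : ∃ᵐ s : ℝ, s ∈ Set.Ioo a b := by
      rw [frequently_ae_mem_iff]
      simp [hab]
    obtain ⟨s₀, hs, h1, h2⟩ := (hfreq.and_eventually (hac.and hvac)).exists
    exact ⟨s₀, hs, h1 ((hmem _).2 hs), h2 ((hmem _).2 hs)⟩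
  refine ⟨⟨fun c d hc hd => ?_, ?_⟩, ?_⟩
  · have h := h₁ (c - s₀) (d - s₀) (fun s hs => by
      rw [hadd, hmem]
      refine Set.ordConnected_Ioo.uIcc_subset hc hd ?_
      simp only [Set.mem_uIcc] at hs ⊢
      grind)
    have h' := AbsolutelyContinuousOnInterval.comp_add_const (a := c) (b := d) (-s₀)
      (by simpa only [sub_eq_add_neg] using h)
    refine h'.of_dist_le fun x y => ?_
    simp only [hadd, neg_add_cancel_right, le_refl]
  · rw [ae_restrict_iff' measurableSet_Ioo]
    filter_upwards [hder] with s hs hsI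
    have h : HasDerivAt (fun t : ℝ => f (p + s • (Ω : R3) + t • (Ω : R3))) _ 0 := hs ((hmem s).2 hsI)
    have h' := HasDerivAt.comp_sub_const s s (by rw [sub_self]; exact h)
    simpa only [hadd, sub_add_cancel] using h'
  · have h := h₂ (a - s₀) (by
      rw [hadd, sub_add_cancel]; exact entry_mem_inflowBoundary hVo hab hI)
    have ht : Tendsto (fun s : ℝ => s - a) (𝓝[>] a) (𝓝[>] 0) := by
      refine tendsto_nhdsWithin_of_tendsto_nhds_of_eventually_within _ ?_ ?_
      · exact (Continuous.tendsto' (f := fun s : ℝ => s - a) (by fun_prop) a 0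
          (sub_self a)).mono_left nhdsWithin_le_nhds
      · filter_upwards [self_mem_nhdsWithin] with s hs using sub_pos.2 (Set.mem_Ioi.1 hs)
    have h' := h.comp ht
    simpa only [Function.comp_def, hadd, sub_add_cancel] using h'

section Directional

variable {V : Set R3} {Ω : S2} {f f' g g' : R3 → ℂ}

theorem IsTransportSolution.integral_re_mul_star_nonneg (hVo : IsOpen V) (hVc : Convex ℝ V)
    (hVb : Bornology.IsBounded V) (hf : IsTransportSolution V Ω f f')
    (hp : IntegrableOn (fun r => f' r * star (f r)) V) :
    0 ≤ ∫ r in V, (f' r * star (f r)).re := by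
  obtain ⟨p, hpm, hpe⟩ := exists_line_coordinates Ω
  have hVm := hVo.measurableSet
  have hpre : IntegrableOn (fun r => (f' r * star (f r)).re) V := hp.re
  rw [setIntegral_eq_integral_line hpm hpe hVm hpre]
  refine integral_nonneg_of_ae ?_
  filter_upwards [ae_ae_line hpm hVm hf.ac, ae_ae_line hpm hVm hf.vacuum,
    ae_ae_line hpm hVm hf.deriv, ae_integrableOn_line hpm hpe hVm hf.integrable,
    ae_integrableOn_line hpm hpe hVm hp] with y h1 h2 h3 h4 h5
  rcases Set.eq_empty_or_nonempty {s : ℝ | p y + s • (Ω : R3) ∈ V} with he | hne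
  · simp [he]
  obtain ⟨a, b, hab, hI⟩ := exists_slice_eq_Ioo hVo hVc hVb Ω (p y) hne
  obtain ⟨hl, h0⟩ := hasLocalACDeriv_line hVo hab hI h1 h2 h3
  rw [hI] at h4 h5 ⊢
  exact hl.integral_re_mul_star_nonneg hab h4 h0 h5

/-- On each chord f vanishes at the entry point and g at the exit, which is the entry for -Ω. The
minus sign appears because g' is the derivative along -Ω. -/
theorem IsTransportSolution.integral_antipodal_eq_zero (hVo : IsOpen V) (hVc : Convex ℝ V)
    (hVb : Bornology.IsBounded V) (hf : IsTransportSolution V Ω f f')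
    (hg : IsTransportSolution V (-Ω) g g')
    (hp : IntegrableOn (fun r => f' r * star (g r) - f r * star (g' r)) V) :
    ∫ r in V, (f' r * star (g r) - f r * star (g' r)) = 0 := by
  obtain ⟨p, hpm, hpe⟩ := exists_line_coordinates Ω
  have hVm := hVo.measurableSet
  -- The parameter of a line in direction -Ω is the negated one, and negation preserves null sets.
  have hflip {P : R3 → Prop} {y : Fin 2 → ℝ}
      (h : ∀ᵐ s : ℝ, p y + s • (Ω : R3) ∈ V → P (p y + s • (Ω : R3))) :
      ∀ᵐ s : ℝ, p y + s • ((-Ω : S2) : R3) ∈ V → P (p y + s • ((-Ω : S2) : R3)) := by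
    have := (Measure.measurePreserving_neg (volume : Measure ℝ)).quasiMeasurePreserving.ae h
    filter_upwards [this] with s hs
    simpa using hs
  rw [setIntegral_eq_integral_line hpm hpe hVm hp]
  refine integral_eq_zero_of_ae ?_
  filter_upwards [ae_ae_line hpm hVm hf.ac, ae_ae_line hpm hVm hf.vacuum,
    ae_ae_line hpm hVm hf.deriv, ae_integrableOn_line hpm hpe hVm hf.integrable,
    ae_integrableOn_line hpm hpe hVm hp, ae_ae_line hpm hVm hg.ac, ae_ae_line hpm hVm hg.vacuum,
    ae_ae_line hpm hVm hg.deriv, ae_integrableOn_line hpm hpe hVm hg.integrable]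
    with y h1 h2 h3 h4 h5 k1 k2 k3 k4
  rcases Set.eq_empty_or_nonempty {s : ℝ | p y + s • (Ω : R3) ∈ V} with he | hne
  · simp [he]
  obtain ⟨a, b, hab, hI⟩ := exists_slice_eq_Ioo hVo hVc hVb Ω (p y) hne
  obtain ⟨hl, h0⟩ := hasLocalACDeriv_line hVo hab hI h1 h2 h3
  have hI' : {s : ℝ | p y + s • ((-Ω : S2) : R3) ∈ V} = Set.Ioo (-b) (-a) := by
    have : ∀ s, p y + s • (Ω : R3) ∈ V ↔ s ∈ Set.Ioo a b := fun s => by rw [← hI]; rfl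
    ext s
    have h := this (-s)
    simp only [Set.mem_ofPred_eq, coe_neg_sphere, smul_neg, neg_smul, Set.mem_Ioo] at h ⊢
    rw [h]
    constructor <;> rintro ⟨_, _⟩ <;> constructor <;> linarith
  obtain ⟨kl, k0⟩ := hasLocalACDeriv_line hVo (neg_lt_neg hab) hI'
    (hflip (P := fun r => ∀ a b : ℝ, (∀ s ∈ Set.uIcc a b, r + s • ((-Ω : S2) : R3) ∈ V) →
      AbsolutelyContinuousOnInterval (fun s : ℝ => g (r + s • ((-Ω : S2) : R3))) a b) k1)
    (hflip (P := fun r => ∀ s : ℝ, (r + s • ((-Ω : S2) : R3), -Ω) ∈ inflowBoundary V →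
      Tendsto (fun t : ℝ => g (r + s • ((-Ω : S2) : R3) + t • ((-Ω : S2) : R3))) (𝓝[>] 0) (𝓝 0))
      k2)
    (hflip (P := fun r => HasLineDerivAt ℝ g (g' r) r ((-Ω : S2) : R3)) k3)
  have kl' := kl.comp_neg.conj
  simp only [neg_neg, coe_neg_sphere, smul_neg, neg_smul] at kl'
  have k0' : Tendsto (fun s => star (g (p y + s • (Ω : R3)))) (𝓝[<] b) (𝓝 0) := by
    have := (k0.comp tendsto_neg_nhdsLT).star
    simpa [Function.comp_def] using this
  rw [hI] at h4 h5 k4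
  have k4' : IntegrableOn (fun s => star (-g' (p y + s • (Ω : R3)))) (Set.Ioo a b) :=
    Complex.conjCLE.toContinuousLinearMap.integrable_comp k4.neg
  have := hl.integral_mul_eq_zero hab kl' h4 k4' h0 k0'
    (h5.congr (ae_of_all _ fun s => by simp [sub_eq_add_neg]))
  rw [hI]
  simpa [sub_eq_add_neg] using this

end Directional

/-! ### The surface measure and Cauchy-Schwarz over directions -/

instance : IsFiniteMeasure surfaceMeasure := by
  unfold surfaceMeasure; infer_instance

theorem surfaceMeasure_real_univ : surfaceMeasure.real Set.univ = 4 * Real.pi := by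
  rw [surfaceMeasure, Measure.toSphere_real_apply_univ, measureReal_def,
    EuclideanSpace.volume_ball_fin_three]
  have : (0 : ℝ) ≤ Real.pi * 4 / 3 := by positivity
  simp [this]
  ring

open scoped Pointwise in
-- The surface measure of a set is proportional to the volume of the cone over it, and x ↦ -x
-- preserves volume.
theorem measurePreserving_neg_surfaceMeasure :
    MeasurePreserving (fun Ω : S2 => -Ω) surfaceMeasure surfaceMeasure := by
  have hmeas : Measurable (fun Ω : S2 => -Ω) :=
    (Continuous.subtype_mk (by fun_prop) _ : Continuous (fun Ω : S2 => -Ω)).measurable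
  refine ⟨hmeas, Measure.ext fun s hs => ?_⟩
  rw [Measure.map_apply hmeas hs, surfaceMeasure, Measure.toSphere_apply' _ (hmeas hs),
    Measure.toSphere_apply' _ hs]
  have himage : ((↑) '' ((fun Ω : S2 => -Ω) ⁻¹' s) : Set R3) = -((↑) '' s) := by
    ext x
    simp only [Set.mem_image, Set.mem_preimage, Set.mem_neg]
    constructor
    · rintro ⟨y, hy, rfl⟩
      exact ⟨-y, hy, by simp⟩
    · rintro ⟨y, hy, hyx⟩
      exact ⟨-y, by simpa using hy, by simp [hyx]⟩
  have hcone : Set.Ioo (0 : ℝ) 1 • -((↑) '' s : Set R3) = -(Set.Ioo (0 : ℝ) 1 • ((↑) '' s)) := by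
    ext x
    simp only [Set.mem_smul, Set.mem_neg]
    constructor
    · rintro ⟨t, ht, y, hy, rfl⟩
      exact ⟨t, ht, -y, hy, by simp⟩
    · rintro ⟨t, ht, y, hy, hyx⟩
      exact ⟨t, ht, -y, by simpa using hy, by simp [hyx]⟩
  rw [himage, hcone, Measure.measure_neg]

/-- Expand 0 ≤ ∫ |f - c|², where c is the mean of f over the sphere of mass 4π. -/
theorem four_pi_mul_sq_norm_le {f : S2 → ℂ} (hf : MemLp f 2 surfaceMeasure) :
    4 * Real.pi * ‖(1 / (4 * (Real.pi : ℂ))) * ∫ Ω, f Ω ∂surfaceMeasure‖ ^ 2 ≤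
      ∫ Ω, ‖f Ω‖ ^ 2 ∂surfaceMeasure := by
  set c := (1 / (4 * (Real.pi : ℂ))) * ∫ Ω, f Ω ∂surfaceMeasure with hc
  have hpi : (Real.pi : ℂ) ≠ 0 := by exact_mod_cast Real.pi_ne_zero
  have hint : ∫ Ω, f Ω ∂surfaceMeasure = ((4 * Real.pi : ℝ) : ℂ) * c := by
    rw [hc]; push_cast; field_simp
  have hf1 : Integrable f surfaceMeasure := hf.integrable one_le_two
  have hf2 : Integrable (fun Ω => ‖f Ω‖ ^ 2) surfaceMeasure := hf.integrable_norm_pow two_ne_zero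
  have h0 : 0 ≤ ∫ Ω, ‖f Ω - c‖ ^ 2 ∂surfaceMeasure := integral_nonneg fun Ω => by positivity
  have hexp : ∀ Ω, ‖f Ω - c‖ ^ 2 = ‖f Ω‖ ^ 2 - 2 * (star c * f Ω).re + ‖c‖ ^ 2 := by
    intro Ω
    rw [← Complex.normSq_eq_norm_sq, ← Complex.normSq_eq_norm_sq, ← Complex.normSq_eq_norm_sq,
      Complex.normSq_apply, Complex.normSq_apply, Complex.normSq_apply]
    simp
    ring
  have hre : Integrable (fun Ω => (star c * f Ω).re) surfaceMeasure := (hf1.const_mul _).re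
  have hval : ∫ Ω, (star c * f Ω).re ∂surfaceMeasure = 4 * Real.pi * ‖c‖ ^ 2 := by
    have := Complex.reCLM.integral_comp_comm (hf1.const_mul (star c))
    simp only [Complex.reCLM_apply] at this
    rw [this, integral_const_mul, hint, ← Complex.normSq_eq_norm_sq, Complex.normSq_apply]
    simp
    ring
  have hsub : Integrable (fun Ω => ‖f Ω‖ ^ 2 - 2 * (star c * f Ω).re) surfaceMeasure :=
    hf2.sub (hre.const_mul 2)
  simp_rw [hexp] at h0
  rw [integral_add hsub (integrable_const _), integral_sub hf2 (hre.const_mul 2),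
    integral_const_mul, hval, integral_const,
    surfaceMeasure_real_univ, smul_eq_mul] at h0
  linarith

theorem ae_ae_of_ae_phaseMeasure {V : Set R3} {P : R3 × S2 → Prop}
    (h : ∀ᵐ z ∂phaseMeasure V, P z) :
    ∀ᵐ Ω ∂surfaceMeasure, ∀ᵐ r ∂volume.restrict V, P (r, Ω) :=
  Measure.ae_ae_of_ae_prod (Measure.measurePreserving_swap.quasiMeasurePreserving.ae h)

/-! ### Cross-sections as bounded multipliers -/

namespace IsCrossSection

variable {V : Set R3} {σ τ : R3 → ℝ}

theorem add (hσ : IsCrossSection V σ) (hτ : IsCrossSection V τ) :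
    IsCrossSection V (fun r => σ r + τ r) := by
  obtain ⟨hm, c, C, hc, h⟩ := hσ
  obtain ⟨km, d, D, hd, k⟩ := hτ
  refine ⟨hm.add km, c + d, C + D, by positivity, fun r hr => ?_⟩
  have := h r hr
  have := k r hr
  constructor <;> linarith

theorem congr (hV : MeasurableSet V) (hσ : IsCrossSection V σ) (h : ∀ r ∈ V, τ r = σ r) :
    IsCrossSection V τ := by
  obtain ⟨hm, c, C, hc, hb⟩ := hσ
  refine ⟨hm.congr ?_, c, C, hc, fun r hr => by rw [h r hr]; exact hb r hr⟩
  filter_upwards [ae_restrict_mem hV] with r hr using (h r hr).symm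

theorem ae_pos (hV : MeasurableSet V) (hσ : IsCrossSection V σ) :
    ∀ᵐ r ∂volume.restrict V, 0 < σ r := by
  obtain ⟨-, c, C, hc, hb⟩ := hσ
  filter_upwards [ae_restrict_mem hV] with r hr using hc.trans_le (hb r hr).1

theorem exists_ae_norm_le (hV : MeasurableSet V) (hσ : IsCrossSection V σ) :
    ∃ C, ∀ᵐ r ∂volume.restrict V, ‖σ r‖ ≤ C := by
  obtain ⟨-, c, C, hc, hb⟩ := hσ
  refine ⟨C, ?_⟩
  filter_upwards [ae_restrict_mem hV] with r hr
  rw [Real.norm_eq_abs, abs_of_pos (hc.trans_le (hb r hr).1)]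
  exact (hb r hr).2

theorem integrable_mul (hV : MeasurableSet V) (hσ : IsCrossSection V σ) {f : R3 → ℝ}
    (hf : IntegrableOn f V) : IntegrableOn (fun r => σ r * f r) V := by
  obtain ⟨C, hC⟩ := hσ.exists_ae_norm_le hV
  exact hf.bdd_mul hσ.1.aestronglyMeasurable hC

theorem memLp_mul (hV : MeasurableSet V) (hσ : IsCrossSection V σ) {f : R3 → ℂ}
    (hf : MemLp f 2 (volume.restrict V)) :
    MemLp (fun r => (σ r : ℂ) * f r) 2 (volume.restrict V) := by
  obtain ⟨C, hC⟩ := hσ.exists_ae_norm_le hV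
  refine hf.of_le_mul (c := C) ?_ ?_
  · exact (Complex.measurable_ofReal.comp_aemeasurable hσ.1).aestronglyMeasurable.mul hf.1
  · filter_upwards [hC] with r hr
    rw [norm_mul, Complex.norm_real]
    gcongr

theorem integrable_phase_mul (hV : MeasurableSet V) (hσ : IsCrossSection V σ) {E : Type*}
    [NormedAddCommGroup E] [NormedSpace ℝ E] {f : R3 × S2 → E}
    (hf : Integrable f (phaseMeasure V)) :
    Integrable (fun z => σ z.1 • f z) (phaseMeasure V) := by
  obtain ⟨C, hC⟩ := hσ.exists_ae_norm_le hV
  refine hf.bdd_smul (C := C) ?_ ?_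
  · exact hσ.1.aestronglyMeasurable.comp_fst
  · exact Measure.quasiMeasurePreserving_fst.ae hC

end IsCrossSection

/-! ### The scalar flux is square integrable -/

section ScalarFlux

variable {V : Set R3} {ψ : R3 → S2 → ℂ}

theorem integral_eq_scalarFlux (ψ : R3 → S2 → ℂ) (r : R3) :
    ∫ Ω, ψ r Ω ∂surfaceMeasure = ((4 * Real.pi : ℝ) : ℂ) * scalarFlux ψ r := by
  have hpi : (Real.pi : ℂ) ≠ 0 := by exact_mod_cast Real.pi_ne_zero
  rw [scalarFlux]; push_cast; field_simp

theorem ae_four_pi_mul_sq_scalarFlux_le (hψ : MemLp (Function.uncurry ψ) 2 (phaseMeasure V)) :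
    ∀ᵐ r ∂volume.restrict V,
      4 * Real.pi * ‖scalarFlux ψ r‖ ^ 2 ≤ ∫ Ω, ‖ψ r Ω‖ ^ 2 ∂surfaceMeasure := by
  have h2 : Integrable (fun z => ‖Function.uncurry ψ z‖ ^ 2) (phaseMeasure V) :=
    hψ.integrable_norm_pow two_ne_zero
  filter_upwards [h2.prod_right_ae, hψ.1.prodMk_left] with r h1 h2
  exact four_pi_mul_sq_norm_le ((memLp_two_iff_integrable_sq_norm h2).2 h1)

theorem memLp_scalarFlux (hψ : MemLp (Function.uncurry ψ) 2 (phaseMeasure V)) :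
    MemLp (scalarFlux ψ) 2 (volume.restrict V) := by
  have hm : AEStronglyMeasurable (scalarFlux ψ) (volume.restrict V) :=
    hψ.1.integral_prod_right'.const_mul _
  rw [memLp_two_iff_integrable_sq_norm hm]
  have h2 : Integrable (fun z => ‖Function.uncurry ψ z‖ ^ 2) (phaseMeasure V) :=
    hψ.integrable_norm_pow two_ne_zero
  refine (h2.integral_prod_left.const_mul (1 / (4 * Real.pi))).mono' (hm.norm.pow 2) ?_
  filter_upwards [ae_four_pi_mul_sq_scalarFlux_le hψ] with r hr
  rw [Real.norm_eq_abs, abs_of_nonneg (by positivity), one_div, ← div_eq_inv_mul,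
    le_div_iff₀' (by positivity)]
  exact hr

end ScalarFlux

/-! ### Integral identities for an eigenpair -/

section Eigenpair

variable {V : Set R3} {σ σS σF : R3 → ℝ} {lam : ℂ} {ψ : R3 → S2 → ℂ}

/-- The isotropic source `σ_S φ + lam σ_F φ` of the angular flux `ψ`. -/
noncomputable def isotropicSource (σS σF : R3 → ℝ) (lam : ℂ) (ψ : R3 → S2 → ℂ) (r : R3) : ℂ :=
  (σS r : ℂ) * scalarFlux ψ r + lam * (σF r : ℂ) * scalarFlux ψ r

theorem isFiniteMeasure_restrict_of_isBounded (hVb : Bornology.IsBounded V) :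
    IsFiniteMeasure ((volume : Measure R3).restrict V) :=
  isFiniteMeasure_restrict.2 hVb.measure_lt_top.ne

theorem memLp_isotropicSource (hV : MeasurableSet V) (hσS : IsCrossSection V σS)
    (hσF : IsCrossSection V σF) (hψ : MemLp (Function.uncurry ψ) 2 (phaseMeasure V)) :
    MemLp (isotropicSource σS σF lam ψ) 2 (volume.restrict V) := by
  have hφ := memLp_scalarFlux hψ
  refine MemLp.ae_eq (ae_of_all _ fun r => ?_)
    ((hσS.memLp_mul hV hφ).add ((hσF.memLp_mul hV hφ).const_mul lam))
  simp [isotropicSource, mul_assoc]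

theorem integrable_source_mul_star (hV : MeasurableSet V) (hσS : IsCrossSection V σS)
    (hσF : IsCrossSection V σF) (hψ : MemLp (Function.uncurry ψ) 2 (phaseMeasure V)) :
    Integrable (fun z : R3 × S2 => isotropicSource σS σF lam ψ z.1 * star (ψ z.1 z.2))
      (phaseMeasure V) :=
  ((memLp_isotropicSource hV hσS hσF hψ).comp_fst surfaceMeasure).integrable_mul hψ.star

theorem integrable_mul_sq_norm (hV : MeasurableSet V) (hσ : IsCrossSection V σ)
    (hψ : MemLp (Function.uncurry ψ) 2 (phaseMeasure V)) :
    Integrable (fun z : R3 × S2 => σ z.1 * ‖ψ z.1 z.2‖ ^ 2) (phaseMeasure V) :=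
  hσ.integrable_phase_mul hV (hψ.integrable_norm_pow two_ne_zero)

theorem IsEigenpair.ae_isTransportSolution (hV : MeasurableSet V) (hVb : Bornology.IsBounded V)
    (hσ : IsCrossSection V σ) (hσS : IsCrossSection V σS) (hσF : IsCrossSection V σF)
    (h : IsEigenpair V σ σS σF lam ψ) :
    ∀ᵐ Ω ∂surfaceMeasure, IsTransportSolution V Ω (fun r => ψ r Ω)
      (fun r => isotropicSource σS σF lam ψ r - (σ r : ℂ) * ψ r Ω) := by
  have := isFiniteMeasure_restrict_of_isBounded hVb
  have : IsFiniteMeasure (phaseMeasure V) := by unfold phaseMeasure; infer_instance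
  have hint : Integrable (fun z : R3 × S2 =>
      isotropicSource σS σF lam ψ z.1 - σ z.1 • ψ z.1 z.2) (phaseMeasure V) :=
    (((memLp_isotropicSource hV hσS hσF h.memLp).comp_fst surfaceMeasure).integrable
      one_le_two).sub (hσ.integrable_phase_mul hV (h.memLp.integrable one_le_two))
  filter_upwards [ae_ae_of_ae_phaseMeasure h.absolutelyContinuous,
    ae_ae_of_ae_phaseMeasure h.vacuum, ae_ae_of_ae_phaseMeasure h.equation,
    hint.prod_left_ae] with Ω h1 h2 h3 h4
  refine ⟨h1, h2, ?_, by simpa only [IntegrableOn, Complex.real_smul] using h4⟩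
  filter_upwards [h3] with r hr
  have heq : isotropicSource σS σF lam ψ r - (σ r : ℂ) * ψ r Ω =
      lineDeriv ℝ (fun x => ψ x Ω) r (Ω : R3) := by
    rw [isotropicSource, ← hr.2]; ring
  rw [heq]
  exact hr.1.hasLineDerivAt

theorem mul_star_re_eq (q z : ℂ) (s : ℝ) :
    ((q - (s : ℂ) * z) * star z).re = (q * star z).re - s * ‖z‖ ^ 2 := by
  rw [← Complex.normSq_eq_norm_sq, Complex.normSq_apply]
  simp
  ring

/-- With z = ψ(r, Ω) and w = ψ(r, -Ω), the collision terms cancel because σ is real and takes the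
same value for both directions. -/
theorem mul_star_sub_eq (q z w : ℂ) (s : ℝ) :
    (q - (s : ℂ) * z) * star w - z * star (q - (s : ℂ) * w) = q * star w - star (q * star z) := by
  simp
  ring

/-- The absorbed flux is at most the real part of the source tested against the flux. -/
theorem IsEigenpair.integral_mul_sq_norm_le (hVo : IsOpen V) (hVc : Convex ℝ V)
    (hVb : Bornology.IsBounded V) (hσ : IsCrossSection V σ) (hσS : IsCrossSection V σS)
    (hσF : IsCrossSection V σF) (h : IsEigenpair V σ σS σF lam ψ) :
    ∫ z, σ z.1 * ‖ψ z.1 z.2‖ ^ 2 ∂phaseMeasure V ≤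
      (∫ z, isotropicSource σS σF lam ψ z.1 * star (ψ z.1 z.2) ∂phaseMeasure V).re := by
  have hV := hVo.measurableSet
  have hq := integrable_source_mul_star (lam := lam) hV hσS hσF h.memLp
  have hn := integrable_mul_sq_norm hV hσ h.memLp
  have hre : Integrable (fun z : R3 × S2 =>
      (isotropicSource σS σF lam ψ z.1 * star (ψ z.1 z.2)).re) (phaseMeasure V) := hq.re
  have hcomm := Complex.reCLM.integral_comp_comm hq
  simp only [Complex.reCLM_apply] at hcomm
  rw [← hcomm, ← sub_nonneg, ← integral_sub hre hn]
  refine (integral_prod_symm _ (hre.sub hn)).symm ▸ integral_nonneg_of_ae ?_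
  filter_upwards [h.ae_isTransportSolution hV hVb hσ hσS hσF, hq.prod_left_ae,
    hn.prod_left_ae] with Ω hΩ h1 h2
  have hp : IntegrableOn (fun r =>
      (isotropicSource σS σF lam ψ r - (σ r : ℂ) * ψ r Ω) * star (ψ r Ω)) V := by
    refine (h1.sub h2.ofReal).congr (ae_of_all _ fun r => ?_)
    have hsq : ((‖ψ r Ω‖ ^ 2 : ℝ) : ℂ) = ψ r Ω * star (ψ r Ω) := by
      rw [← Complex.normSq_eq_norm_sq]; exact (Complex.mul_conj _).symm
    change _ - ((σ r * ‖ψ r Ω‖ ^ 2 : ℝ) : ℂ) = _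
    rw [Complex.ofReal_mul, hsq]
    ring
  have := hΩ.integral_re_mul_star_nonneg hVo hVc hVb hp
  simp only [mul_star_re_eq] at this
  exact this

/-- The source tested against the flux is real. -/
theorem IsEigenpair.integral_source_mul_star_im (hVo : IsOpen V) (hVc : Convex ℝ V)
    (hVb : Bornology.IsBounded V) (hσ : IsCrossSection V σ) (hσS : IsCrossSection V σS)
    (hσF : IsCrossSection V σF) (h : IsEigenpair V σ σS σF lam ψ) :
    (∫ z, isotropicSource σS σF lam ψ z.1 * star (ψ z.1 z.2) ∂phaseMeasure V).im = 0 := by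
  have hV := hVo.measurableSet
  have hq := integrable_source_mul_star (lam := lam) hV hσS hσF h.memLp
  set I : S2 → ℂ := fun Ω => ∫ r in V, isotropicSource σS σF lam ψ r * star (ψ r Ω) with hI
  have hJ : ∫ z, isotropicSource σS σF lam ψ z.1 * star (ψ z.1 z.2) ∂phaseMeasure V =
      ∫ Ω, I Ω ∂surfaceMeasure := integral_prod_symm _ hq
  have hneg := measurePreserving_neg_surfaceMeasure
  have hanti : ∀ᵐ Ω ∂surfaceMeasure, I (-Ω) = star (I Ω) := by
    filter_upwards [h.ae_isTransportSolution hV hVb hσ hσS hσF, hq.prod_left_ae,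
      hneg.quasiMeasurePreserving.ae (h.ae_isTransportSolution hV hVb hσ hσS hσF),
      hneg.quasiMeasurePreserving.ae hq.prod_left_ae] with Ω h1 h2 h3 h4
    have h2' : Integrable (fun r => star (isotropicSource σS σF lam ψ r * star (ψ r Ω)))
      (volume.restrict V) := Complex.conjCLE.toContinuousLinearMap.integrable_comp h2
    have hcomm : ∫ r in V, star (isotropicSource σS σF lam ψ r * star (ψ r Ω)) = star (I Ω) :=
      integral_conj
    have hz := h1.integral_antipodal_eq_zero hVo hVc hVb h3
      (by simp only [mul_star_sub_eq]; exact h4.sub h2')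
    simp only [mul_star_sub_eq] at hz
    rw [integral_sub h4 h2', hcomm, sub_eq_zero] at hz
    exact hz
  -- Invariance of the surface measure under Ω ↦ -Ω turns the pointwise identity into self-conjugacy
  -- of the total integral.
  have hstar : ∫ Ω, I Ω ∂surfaceMeasure = star (∫ Ω, I Ω ∂surfaceMeasure) := by
    have hemb : MeasurableEmbedding (fun Ω : S2 => -Ω) :=
      (MeasurableEquiv.ofInvolutive (fun Ω : S2 => -Ω) neg_neg hneg.measurable).measurableEmbedding
    calc ∫ Ω, I Ω ∂surfaceMeasure = ∫ Ω, I (-Ω) ∂surfaceMeasure := (hneg.integral_comp hemb I).symm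
      _ = ∫ Ω, star (I Ω) ∂surfaceMeasure := integral_congr_ae hanti
      _ = _ := integral_conj
  rw [hJ]
  exact Complex.conj_eq_iff_im.1 hstar.symm

/-- The source is constant in Ω, so integrating ψ̄ over directions leaves the factor 4π φ̄. -/
theorem integral_source_mul_star_eq (hV : MeasurableSet V) (hσS : IsCrossSection V σS)
    (hσF : IsCrossSection V σF) (hψ : MemLp (Function.uncurry ψ) 2 (phaseMeasure V)) :
    ∫ z, isotropicSource σS σF lam ψ z.1 * star (ψ z.1 z.2) ∂phaseMeasure V =
      ((4 * Real.pi : ℝ) : ℂ) * (((∫ r in V, σS r * ‖scalarFlux ψ r‖ ^ 2 : ℝ) : ℂ) +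
        lam * ((∫ r in V, σF r * ‖scalarFlux ψ r‖ ^ 2 : ℝ) : ℂ)) := by
  have hφ2 : IntegrableOn (fun r => ‖scalarFlux ψ r‖ ^ 2) V :=
    (memLp_scalarFlux hψ).integrable_norm_pow two_ne_zero
  have hS : Integrable (fun r => ((σS r * ‖scalarFlux ψ r‖ ^ 2 : ℝ) : ℂ)) (volume.restrict V) :=
    (hσS.integrable_mul hV hφ2).ofReal
  have hF : Integrable (fun r => ((σF r * ‖scalarFlux ψ r‖ ^ 2 : ℝ) : ℂ)) (volume.restrict V) :=
    (hσF.integrable_mul hV hφ2).ofReal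
  have hinner : ∀ r, ∫ Ω, isotropicSource σS σF lam ψ r * star (ψ r Ω) ∂surfaceMeasure =
      ((4 * Real.pi : ℝ) : ℂ) * (((σS r * ‖scalarFlux ψ r‖ ^ 2 : ℝ) : ℂ) +
        lam * ((σF r * ‖scalarFlux ψ r‖ ^ 2 : ℝ) : ℂ)) := by
    intro r
    have hstar : ∫ Ω, star (ψ r Ω) ∂surfaceMeasure =
        ((4 * Real.pi : ℝ) : ℂ) * star (scalarFlux ψ r) := by
      refine (integral_conj (f := fun Ω => ψ r Ω)).trans ?_
      rw [integral_eq_scalarFlux, map_mul, Complex.conj_ofReal]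
      rfl
    have hsq : ((‖scalarFlux ψ r‖ ^ 2 : ℝ) : ℂ) = scalarFlux ψ r * star (scalarFlux ψ r) := by
      rw [← Complex.normSq_eq_norm_sq]; exact (Complex.mul_conj _).symm
    rw [integral_const_mul, hstar, Complex.ofReal_mul (σS r), Complex.ofReal_mul (σF r), hsq,
      isotropicSource]
    ring
  refine (integral_prod _ (integrable_source_mul_star hV hσS hσF hψ)).trans ?_
  simp only [hinner]
  rw [integral_const_mul, integral_add hS (hF.const_mul lam), integral_const_mul,
    integral_complex_ofReal, integral_complex_ofReal]

theorem four_pi_mul_integral_sq_scalarFlux_le (hV : MeasurableSet V) (hσ : IsCrossSection V σ)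
    (hψ : MemLp (Function.uncurry ψ) 2 (phaseMeasure V)) :
    4 * Real.pi * ∫ r in V, σ r * ‖scalarFlux ψ r‖ ^ 2 ≤
      ∫ z, σ z.1 * ‖ψ z.1 z.2‖ ^ 2 ∂phaseMeasure V := by
  have hφ2 : IntegrableOn (fun r => ‖scalarFlux ψ r‖ ^ 2) V :=
    (memLp_scalarFlux hψ).integrable_norm_pow two_ne_zero
  have hn := integrable_mul_sq_norm hV hσ hψ
  refine le_of_le_of_eq ?_ (integral_prod _ hn).symm
  rw [← integral_const_mul]
  refine integral_mono_ae ((hσ.integrable_mul hV hφ2).const_mul _) hn.integral_prod_left ?_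
  filter_upwards [hσ.ae_pos hV, ae_four_pi_mul_sq_scalarFlux_le hψ] with r h1 h2
  rw [integral_const_mul]
  calc 4 * Real.pi * (σ r * ‖scalarFlux ψ r‖ ^ 2) = σ r * (4 * Real.pi * ‖scalarFlux ψ r‖ ^ 2) := by
        ring
    _ ≤ _ := mul_le_mul_of_nonneg_left h2 h1.le

/-- An eigenfunction has nonvanishing scalar flux. -/
theorem IsEigenpair.integral_mul_sq_scalarFlux_pos (hVo : IsOpen V) (hVc : Convex ℝ V)
    (hVb : Bornology.IsBounded V) (hσ : IsCrossSection V σ) (hσS : IsCrossSection V σS)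
    (hσF : IsCrossSection V σF) (h : IsEigenpair V σ σS σF lam ψ) :
    0 < ∫ r in V, σF r * ‖scalarFlux ψ r‖ ^ 2 := by
  have hV := hVo.measurableSet
  have hφ2 : IntegrableOn (fun r => ‖scalarFlux ψ r‖ ^ 2) V :=
    (memLp_scalarFlux h.memLp).integrable_norm_pow two_ne_zero
  have hnn : 0 ≤ᵐ[volume.restrict V] fun r => σF r * ‖scalarFlux ψ r‖ ^ 2 := by
    filter_upwards [hσF.ae_pos hV] with r hr using by positivity
  refine lt_of_le_of_ne (integral_nonneg_of_ae hnn) fun h0 => h.nonzero ?_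
  have hφ0 : ∀ᵐ r ∂volume.restrict V, scalarFlux ψ r = 0 := by
    filter_upwards [(integral_eq_zero_iff_of_nonneg_ae hnn (hσF.integrable_mul hV hφ2)).1 h0.symm,
      hσF.ae_pos hV] with r hr hpos
    simpa [hpos.ne'] using hr
  -- Without scalar flux there is no source, and the energy estimate then bounds ∫∫ σ|ψ|² by 0.
  have hJ : ∫ z, isotropicSource σS σF lam ψ z.1 * star (ψ z.1 z.2) ∂phaseMeasure V = 0 := by
    refine integral_eq_zero_of_ae ?_
    filter_upwards [Measure.quasiMeasurePreserving_fst.ae hφ0] with z hz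
    simp [isotropicSource, hz]
  have hle := h.integral_mul_sq_norm_le hVo hVc hVb hσ hσS hσF
  rw [hJ, Complex.zero_re] at hle
  have hpos : ∀ᵐ z ∂phaseMeasure V, 0 < σ z.1 :=
    Measure.quasiMeasurePreserving_fst.ae (hσ.ae_pos hV)
  have hnn' : 0 ≤ᵐ[phaseMeasure V] fun z => σ z.1 * ‖ψ z.1 z.2‖ ^ 2 := by
    filter_upwards [hpos] with z hz using by positivity
  have hz := (integral_eq_zero_iff_of_nonneg_ae hnn' (integrable_mul_sq_norm hV hσ h.memLp)).1
    (le_antisymm hle (integral_nonneg_of_ae hnn'))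
  filter_upwards [hz, hpos] with z h1 h2
  simpa [Function.uncurry, h2.ne'] using h1

end Eigenpair

/-! ### Reality and positivity of the eigenvalues -/

theorem mainTheorem4 (V : Set R3) (hVo : IsOpen V) (hVc : Convex ℝ V)
    (hVb : Bornology.IsBounded V) (σ σS σF σA : R3 → ℝ)
    (hσS : IsCrossSection V σS) (hσF : IsCrossSection V σF) (hσA : IsCrossSection V σA)
    (hσ : ∀ r ∈ V, σ r = σS r + σF r + σA r)
    (lam : ℂ) (hlam : IsCriticalityEigenvalue V σ σS σF lam) :
    lam.im = 0 ∧ 0 < lam.re := by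
  obtain ⟨ψ, h⟩ := hlam
  have hV := hVo.measurableSet
  have hσc : IsCrossSection V σ := ((hσS.add hσF).add hσA).congr hV hσ
  have hφ2 : IntegrableOn (fun r => ‖scalarFlux ψ r‖ ^ 2) V :=
    (memLp_scalarFlux h.memLp).integrable_norm_pow two_ne_zero
  have hre := h.integral_mul_sq_norm_le hVo hVc hVb hσc hσS hσF
  have him := h.integral_source_mul_star_im hVo hVc hVb hσc hσS hσF
  have hB := h.integral_mul_sq_scalarFlux_pos hVo hVc hVb hσc hσS hσF
  have hcs := four_pi_mul_integral_sq_scalarFlux_le hV hσc h.memLp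
  rw [integral_source_mul_star_eq hV hσS hσF h.memLp] at hre him
  -- The absorption term is nonnegative and is dropped.
  have hsum : (∫ r in V, σS r * ‖scalarFlux ψ r‖ ^ 2) + ∫ r in V, σF r * ‖scalarFlux ψ r‖ ^ 2 ≤
      ∫ r in V, σ r * ‖scalarFlux ψ r‖ ^ 2 := by
    rw [← integral_add (hσS.integrable_mul hV hφ2) (hσF.integrable_mul hV hφ2)]
    refine integral_mono_ae ((hσS.integrable_mul hV hφ2).add (hσF.integrable_mul hV hφ2))
      (hσc.integrable_mul hV hφ2) ?_
    filter_upwards [ae_restrict_mem hV, hσA.ae_pos hV] with r hr hpos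
    rw [hσ r hr]
    nlinarith [mul_nonneg hpos.le (sq_nonneg ‖scalarFlux ψ r‖)]
  have hpi : 0 < 4 * Real.pi := by positivity
  simp only [Complex.re_ofReal_mul, Complex.im_ofReal_mul, Complex.add_re, Complex.add_im,
    Complex.ofReal_re, Complex.ofReal_im, Complex.re_mul_ofReal, Complex.im_mul_ofReal,
    zero_add] at hre him
  have hmain := le_of_mul_le_mul_left (hcs.trans hre) hpi
  -- The imaginary part follows from 4π Im λ ∫ σ_F |φ|² = 0. For the real part, `hsum` and `hmain`
  -- give Re λ ∫ σ_F |φ|² ≥ ∫ σ_F |φ|² > 0.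
  refine ⟨?_, pos_of_mul_pos_left ?_ hB.le⟩
  · simpa [hpi.ne', hB.ne'] using him
  · linarith
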